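/- Let $d\ge 1$, let $a_0,\dots,a_d$ be positive integers and $p(x)=a_0+a_1x+\dots+a_dx^d$. The Bratteli diagram of $p$ has the vertices $(n,k)$, $0\le k\le dn$, at level $n\ge 0$, and exactly $a_i$ edges from $(n,k)$ to $(n+1,k+i)$ for $0\le i\le d$ (and no other edges). Parallel edges are numbered from left to right, and the edges ending in a common vertex are ordered from left to right: first by their source (a smaller $k$ comes first), then by their number. Let $X_{p(x)}$ be the space of infinite edge paths $\gamma=\gamma_0\gamma_1\dots$ starting at $(0,0)$, with the topology and Borel $\sigma$-algebra generated by the cylinder sets; $(n,k_n(\gamma))$ is the vertex of $\gamma$ at level $n$. For two paths put $\gamma<\xi$ if, for some $n$, they have the same vertices from level $n+1$ on and the same edges $\gamma_m=\xi_m$ for all $m>n$, while $\gamma_n<\xi_n$. The adic transformation $T_{p(x)}:X_{p(x)}\to X_{p(x)}$ maps $\gamma$ to the smallest path larger than $\gamma$ if there is one. The paths without such a successor are the paths $\gamma_{\max}^k$, $k\in\{0,1,2,\dots\}\cup\{\infty\}$, where $\gamma_{\max}^k$ runs through the vertices $(n,\min(k,dn))$ along the largest edge between consecutive vertices; with $\gamma_{\min}^k$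 the path through the vertices $(n,dn-\min(k,dn))$ along the smallest edge between consecutive vertices, one sets $T_{p(x)}\gamma_{\max}^k=\gamma_{\min}^k$ for $0<k<\infty$, $T_{p(x)}\gamma_{\max}^0=\gamma_{\min}^\infty$ and $T_{p(x)}\gamma_{\max}^\infty=\gamma_{\min}^0$. At every vertex the outgoing edges are labelled by the same set of pairs $(i,j)$ (the $j$-th edge from $(n,k)$ to $(n+1,k+i)$); a Bernoulli measure on $X_{p(x)}$ is one under which the labels of $\gamma_0,\gamma_1,\dots$ are independent and identically distributed. A measure is fully supported if every cylinder set has positive measure. Then there are exactly two $T_{p(x)}$-invariant ergodic Borel probability measures on $X_{p(x)}$ that are not fully supported: the Bernoulli measure $\mu_{0}$ giving weight $1/a_0$ to each of the $a_0$ leftmost edges ($i=0$) and weight $0$ to all other edges, and the Bernoulli measure $\mu_{d}$ giving weight $1/a_d$ to each of the $a_d$ rightmost edges ($i=d$) and weight $0$ to all other edges. They are odometer measures on the far left and far right paths: for $i\in\{0,d\}$ the map sending a sequence $x\in\{0,\dots,a_i-1\}^{\mathbb N}$ to the path whose $n$-th edge is the edge of increment $i$ with number $x_n$ is a bijection onto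 $\{\gamma: k_n(\gamma)=in\text{ for all }n\}$, it intertwines the $a_i$-adic odometer (addition of $1$ with carry to the right) with $T_{p(x)}$, and it carries the uniform product measure to $\mu_i$. -/

import Mathlib

open MeasureTheory
open scoped ENNReal

namespace PolyAdic

/-- The polynomial `p(x) = a 0 + a 1 * x + ... + a d * x ^ d` with positive integer coefficients
is given by its tuple of coefficients. In its Bratteli diagram, level `n` has the vertices
`(n, k)`, `0 ≤ k ≤ d * n`, and there are `a i` edges from `(n, k)` to `(n + 1, k + i)`,
`0 ≤ i ≤ d`. So, at every vertex, an outgoing edge is a pair `⟨i, j⟩` with `j < a i`: the `j`-th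
edge, counted from left to right, among those which go to `(n + 1, k + i)`. -/
abbrev Edge {d : ℕ} (a : Fin (d + 1) → ℕ+) : Type :=
  Σ i : Fin (d + 1), Fin (a i : ℕ)

/-- Infinite edge paths from the root `(0, 0)`. As every vertex has the same outgoing edges, a path
is an arbitrary sequence of edge labels. The topology is the product of the discrete topologies
(the one of the metric `2 ^ (-j)`, `j` the first index of disagreement), and the `σ`-algebra is the
product (Borel) `σ`-algebra. -/
abbrev Path {d : ℕ} (a : Fin (d + 1) → ℕ+) : Type :=
  ℕ → Edge a

variable {d : ℕ} {a : Fin (d + 1) → ℕ+}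

/-- `(n, vertex γ n)` is the vertex through which the path `γ` passes at level `n`. -/
def vertex (γ : Path a) (n : ℕ) : ℕ :=
  ∑ m ∈ Finset.range n, ((γ m).1 : ℕ)

/-- The left to right order of two edges that end in the same vertex: an edge with a larger
increment `i` has its source further to the left; parallel edges are ordered by their index. -/
def EdgeLT (e e' : Edge a) : Prop :=
  e'.1 < e.1 ∨ (e.1 = e'.1 ∧ (e.2 : ℕ) < (e'.2 : ℕ))

/-- The partial order on paths: `γ` and `ξ` agree as paths in the diagram after level `n + 1`
(in particular both pass through the same vertex at level `n + 1`), and the edges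
from level `n` to level `n + 1` satisfy `γ n < ξ n`. -/
def PathLT (γ ξ : Path a) : Prop :=
  ∃ n, (∀ m, n < m → γ m = ξ m) ∧ vertex γ (n + 1) = vertex ξ (n + 1) ∧ EdgeLT (γ n) (ξ n)

/-- `ξ` is the next largest path after `γ`. -/
def IsSuccessor (γ ξ : Path a) : Prop :=
  PathLT γ ξ ∧ ∀ η, PathLT γ η → η = ξ ∨ PathLT ξ η

/-- `min k (d * n)`: the vertex of the maximal path `γ_max^k` at level `n`. -/
noncomputable def diagVertex (d : ℕ) (k : ℕ∞) (n : ℕ) : ℕ :=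
  (min k ((d * n : ℕ) : ℕ∞)).toNat

theorem diagVertex_step_lt (d : ℕ) (k : ℕ∞) (n : ℕ) :
    diagVertex d k (n + 1) - diagVertex d k n < d + 1 := by
  have h : ∀ m, diagVertex d k m = d * m ∨ ∃ l : ℕ, k = l ∧ l ≤ d * m ∧ diagVertex d k m = l := by
    intro m
    rcases le_total k ((d * m : ℕ) : ℕ∞) with hk | hk
    · obtain ⟨l, rfl⟩ := ENat.ne_top_iff_exists.mp (ne_top_of_le_ne_top (ENat.natCast_ne_top _) hk)
      exact Or.inr ⟨l, rfl, by exact_mod_cast hk, by rw [diagVertex, min_eq_left hk]; rfl⟩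
    · exact Or.inl (by rw [diagVertex, min_eq_right hk]; rfl)
  have hs : d * (n + 1) = d * n + d := by ring
  have h1 := h (n + 1)
  rcases h n with h0 | ⟨l, hl, hle, h0⟩
  · rcases h1 with h1 | ⟨l, hl, hle, h1⟩ <;> omega
  · rcases h1 with h1 | ⟨l', hl', hle', h1⟩
    · have : diagVertex d k (n + 1) = l := by
        have hk : k ≤ ((d * (n + 1) : ℕ) : ℕ∞) := by rw [hl]; exact_mod_cast (by omega)
        rw [diagVertex, min_eq_left hk, hl]; rfl
      omega
    · have : l = l' := by exact_mod_cast hl.symm.trans hl'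
      omega

/-- The increment of the maximal path `γ_max^k` from level `n` to level `n + 1`. -/
noncomputable def diagStep (d : ℕ) (k : ℕ∞) (n : ℕ) : Fin (d + 1) :=
  ⟨diagVertex d k (n + 1) - diagVertex d k n, diagVertex_step_lt d k n⟩

/-- The path `γ_max^k`, `k ∈ {0, 1, ...} ∪ {∞}`: it passes through the vertices
`(n, min k (d * n))` along maximal edges. -/
noncomputable def maxPath (a : Fin (d + 1) → ℕ+) (k : ℕ∞) : Path a := fun n =>
  ⟨diagStep d k n, ⟨(a (diagStep d k n) : ℕ) - 1, Nat.sub_lt (a _).pos one_pos⟩⟩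

/-- The path `γ_min^k`, `k ∈ {0, 1, ...} ∪ {∞}`: it passes through the vertices
`(n, d * n - min k (d * n))` along minimal edges. -/
noncomputable def minPath (a : Fin (d + 1) → ℕ+) (k : ℕ∞) : Path a := fun n =>
  ⟨(diagStep d k n).rev, ⟨0, (a _).pos⟩⟩

open Classical in
/-- The adic (Bratteli-Vershik) transformation `T`: a path is mapped to its successor if it has one;
the paths without successor are the `γ_max^k`, and `T γ_max^k = γ_min^k` for `0 < k < ∞`,
`T γ_max^0 = γ_min^∞`, `T γ_max^∞ = γ_min^0`. -/
noncomputable def adic (a : Fin (d + 1) → ℕ+) (γ : Path a) : Path a :=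
  if h : ∃ ξ, IsSuccessor γ ξ then h.choose
  else if h : ∃ k : ℕ∞, γ = maxPath a k then minPath a (Equiv.swap 0 ⊤ h.choose)
  else γ

/-- Every cylinder set has positive measure. -/
def FullySupported (μ : Measure (Path a)) : Prop :=
  ∀ (γ : Path a) (n : ℕ), 0 < μ (PiNat.cylinder γ n)

/-- The Bernoulli measure on paths in which the edges are independent with weights `w`. -/
noncomputable def bernoulliMeasure (w : PMF (Edge a)) : Measure (Path a) :=
  Measure.infinitePi fun _ : ℕ => w.toMeasure

/-- The edge weights which give `1 / a i` to each of the `a i` edges with increment `i`, and `0` to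
all other edges. For `i = 0` these are the leftmost edges, for `i = d` the rightmost edges. -/
noncomputable def stepWeights (a : Fin (d + 1) → ℕ+) (i : Fin (d + 1)) : PMF (Edge a) :=
  PMF.ofFintype (fun e => if e.1 = i then ((a i : ℕ) : ℝ≥0∞)⁻¹ else 0) <| by
    rw [Fintype.sum_sigma, Finset.sum_eq_single i]
    · have h : ((a i : ℕ) : ℝ≥0∞) ≠ 0 := Nat.cast_ne_zero.mpr (a i).ne_zero
      simp [ENNReal.mul_inv_cancel h (ENNReal.natCast_ne_top _)]
    · intro j _ hj
      simp [hj]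
    · simp

/-- The odometer on `{0, ..., b - 1} ^ ℕ`: addition of `1` with carry to the right. -/
def odometer (b : ℕ) (x : ℕ → Fin b) : ℕ → Fin b := fun n =>
  if ∀ m < n, (x m : ℕ) + 1 = b then finRotate b (x n) else x n

/-- The invariant measure of the odometer: independent, uniformly distributed digits. -/
noncomputable def odometerMeasure (b : ℕ+) : Measure (ℕ → Fin (b : ℕ)) :=
  Measure.infinitePi fun _ : ℕ =>
    (haveI : Nonempty (Fin (b : ℕ)) := ⟨⟨0, b.pos⟩⟩
     PMF.uniformOfFintype (Fin (b : ℕ))).toMeasure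

/-- The path all of whose edges have increment `i`, with the indices prescribed by `x`. -/
def sidePath (a : Fin (d + 1) → ℕ+) (i : Fin (d + 1)) (x : ℕ → Fin (a i : ℕ)) : Path a :=
  fun n => ⟨i, x n⟩

end PolyAdic

namespace PolyAdic

variable {d : ℕ} {a : Fin (d + 1) → ℕ+}

/-! ### Edges and vertices -/

/-! Paths with a common tail form a finite, linearly ordered set through which the adic map steps
one by one. Hence an invariant measure gives equal mass to all cylinders ending in the same vertex
(`measure_cylinder_eq`); in particular it is invariant under transpositions of edges.

If one cylinder, ending in `(n, v)`, is null, then so is every cylinder ending in a vertex reachable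
from `(n, v)`. Almost every path thus avoids a cone: it stays to its left and finally has only
increments `0`, or passes to its right and finally has only increments `d`. Exchangeability turns
"finally" into "always" (`ae_forall_of_eventually`), so the measure lives on the two sides
(`ae_far_left_or_far_right`).

On one side all cylinders of length `n` that meet it end in a single vertex, so a finite invariant
measure there is a multiple of the Bernoulli measure (`eq_smul_bernoulliMeasure`). This uniqueness,
applied to restrictions to invariant sets, also gives ergodicity. Invariance of the Bernoulli
measure comes from the conjugacy with the odometer (`semiconj_sidePath`). -/

theorem edge_ext {e e' : Edge a} (h₁ : e.1 = e'.1) (h₂ : (e.2 : ℕ) = e'.2) : e = e' := by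
  obtain ⟨i, j⟩ := e
  obtain ⟨i', j'⟩ := e'
  obtain rfl : i = i' := h₁
  exact congrArg _ (Fin.ext h₂)

theorem EdgeLT.irrefl (e : Edge a) : ¬ EdgeLT e e := by
  simp [EdgeLT]

theorem EdgeLT.trans {e f g : Edge a} (h₁ : EdgeLT e f) (h₂ : EdgeLT f g) : EdgeLT e g := by
  simp only [EdgeLT, Fin.lt_def, Fin.ext_iff] at *
  omega

theorem EdgeLT.trichotomy {e f : Edge a} (h : e ≠ f) : EdgeLT e f ∨ EdgeLT f e := by
  by_contra hn
  simp only [EdgeLT, Fin.lt_def, Fin.ext_iff] at hn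
  exact h (edge_ext (Fin.ext (by omega)) (by omega))

theorem vertex_succ (γ : Path a) (n : ℕ) : vertex γ (n + 1) = vertex γ n + ((γ n).1 : ℕ) :=
  Finset.sum_range_succ _ _

theorem vertex_zero (γ : Path a) : vertex γ 0 = 0 := rfl

theorem vertex_mono (γ : Path a) : Monotone (vertex γ) :=
  monotone_nat_of_le_succ fun n => by rw [vertex_succ]; omega

theorem vertex_add_le (γ : Path a) (n l : ℕ) : vertex γ (n + l) ≤ vertex γ n + d * l := by
  induction l with
  | zero => simp
  | succ l ih =>
    rw [← add_assoc, vertex_succ, Nat.mul_succ]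
    have := (γ (n + l)).1.is_lt
    omega

theorem vertex_le (γ : Path a) (n : ℕ) : vertex γ n ≤ d * n := by
  simpa [vertex_zero] using vertex_add_le γ 0 n

theorem vertex_congr {γ ξ : Path a} {n : ℕ} (h : ∀ m < n, γ m = ξ m) : vertex γ n = vertex ξ n :=
  Finset.sum_congr rfl fun m hm => by rw [h m (Finset.mem_range.mp hm)]

theorem vertex_eq_iff_of_agree {γ ξ : Path a} {n m : ℕ} (hnm : n ≤ m)
    (h : ∀ l, n ≤ l → l < m → γ l = ξ l) :
    vertex γ m = vertex ξ m ↔ vertex γ n = vertex ξ n := by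
  induction m, hnm using Nat.le_induction with
  | base => rfl
  | succ m hm ih =>
    rw [vertex_succ, vertex_succ, h m hm (by omega), Nat.add_right_cancel_iff]
    exact ih fun l h₁ h₂ => h l h₁ (by omega)

/-! ### Splicing paths -/

/-- The sequence of edges which follows `γ` before level `n`, and `ξ` afterwards. -/
def splice (n : ℕ) (γ ξ : Path a) : Path a := fun m => if m < n then γ m else ξ m

theorem splice_of_lt {n m : ℕ} (h : m < n) (γ ξ : Path a) : splice n γ ξ m = γ m := if_pos h

theorem splice_of_le {n m : ℕ} (h : n ≤ m) (γ ξ : Path a) : splice n γ ξ m = ξ m :=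
  if_neg (not_lt.mpr h)

theorem splice_eq_self {n : ℕ} {γ ξ : Path a} (h : ∀ m < n, γ m = ξ m) : splice n γ ξ = ξ := by
  funext m
  rcases lt_or_ge m n with hm | hm
  · rw [splice_of_lt hm, h m hm]
  · rw [splice_of_le hm]

theorem splice_splice_left (n : ℕ) (γ ξ η : Path a) : splice n (splice n γ ξ) η = splice n γ η := by
  funext m
  by_cases hm : m < n <;> simp [splice, hm]

theorem splice_eq_left {n : ℕ} {γ ξ : Path a} (h : ∀ m, n ≤ m → γ m = ξ m) : splice n γ ξ = γ := by
  funext m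
  rcases lt_or_ge m n with hm | hm
  · rw [splice_of_lt hm]
  · rw [splice_of_le hm, h m hm]

theorem vertex_splice {n m : ℕ} (h : m ≤ n) (γ ξ : Path a) :
    vertex (splice n γ ξ) m = vertex γ m :=
  vertex_congr fun _ hl => splice_of_lt (hl.trans_le h) γ ξ

theorem splice_mem_cylinder (n : ℕ) (γ ξ : Path a) : splice n γ ξ ∈ PiNat.cylinder γ n :=
  fun _ hm => splice_of_lt hm γ ξ

theorem cylinder_splice (n : ℕ) (γ ξ : Path a) :
    PiNat.cylinder (splice n γ ξ) n = PiNat.cylinder γ n :=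
  PiNat.mem_cylinder_iff_eq.mp (splice_mem_cylinder n γ ξ)

/-- Every vertex `(n + l, vertex γ n + v)` with `v ≤ d * l` is reached by a path that begins
like `γ`. -/
theorem exists_path_through (γ : Path a) (n l v : ℕ) (hv : v ≤ d * l) :
    ∃ ξ ∈ PiNat.cylinder γ n, vertex ξ (n + l) = vertex γ n + v := by
  induction l generalizing v with
  | zero => exact ⟨γ, PiNat.self_mem_cylinder γ n, by simp_all⟩
  | succ l ih =>
    obtain ⟨ξ, hξ, hv'⟩ := ih (v - min v d) (by rw [Nat.mul_succ] at hv; omega)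
    let i : Fin (d + 1) := ⟨min v d, by omega⟩
    refine ⟨splice (n + l) ξ fun _ => ⟨i, ⟨0, (a i).pos⟩⟩, fun m hm => ?_, ?_⟩
    · rw [splice_of_lt (by omega), hξ m hm]
    · rw [← add_assoc, vertex_succ, vertex_splice le_rfl, splice_of_le le_rfl, hv']
      simp only [i]
      omega

/-! ### The order on paths -/

/-- `γ` and `ξ` pass through the same vertex at level `n` and agree from there on. -/
def SameTail (n : ℕ) (γ ξ : Path a) : Prop :=
  (∀ m, n ≤ m → γ m = ξ m) ∧ vertex γ n = vertex ξ n

theorem SameTail.symm {n : ℕ} {γ ξ : Path a} (h : SameTail n γ ξ) : SameTail n ξ γ :=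
  ⟨fun m hm => (h.1 m hm).symm, h.2.symm⟩

theorem SameTail.trans {n : ℕ} {γ ξ η : Path a} (h₁ : SameTail n γ ξ) (h₂ : SameTail n ξ η) :
    SameTail n γ η :=
  ⟨fun m hm => (h₁.1 m hm).trans (h₂.1 m hm), h₁.2.trans h₂.2⟩

theorem SameTail.mono {n m : ℕ} {γ ξ : Path a} (h : SameTail n γ ξ) (hnm : n ≤ m) :
    SameTail m γ ξ :=
  ⟨fun l hl => h.1 l (hnm.trans hl),
    (vertex_eq_iff_of_agree hnm fun l hl _ => h.1 l hl).mpr h.2⟩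

theorem SameTail.splice {n : ℕ} {γ ξ : Path a} (h : vertex γ n = vertex ξ n) (η : Path a) :
    SameTail n (splice n γ η) (splice n ξ η) :=
  ⟨fun m hm => by rw [splice_of_le hm, splice_of_le hm],
    by rwa [vertex_splice le_rfl, vertex_splice le_rfl]⟩

theorem finite_sameTail (n : ℕ) (γ : Path a) : {ξ | SameTail n γ ξ}.Finite := by
  refine Set.Finite.of_injOn (f := fun ξ (m : Fin n) => ξ m) (t := Set.univ)
    (fun _ _ => Set.mem_univ _) ?_ Set.finite_univ
  intro ξ hξ η hη h
  funext m
  rcases lt_or_ge m n with hm | hm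
  · exact congrFun h ⟨m, hm⟩
  · exact (hξ.1 m hm).symm.trans (hη.1 m hm)

theorem pathLT_iff {γ ξ : Path a} :
    PathLT γ ξ ↔ ∃ n, SameTail (n + 1) γ ξ ∧ EdgeLT (γ n) (ξ n) :=
  exists_congr fun _ => and_assoc.symm

theorem PathLT.irrefl (γ : Path a) : ¬ PathLT γ γ := by
  rintro ⟨n, -, -, h⟩
  exact EdgeLT.irrefl _ h

theorem PathLT.trans {γ ξ η : Path a} (h₁ : PathLT γ ξ) (h₂ : PathLT ξ η) : PathLT γ η := by
  rw [pathLT_iff] at *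
  obtain ⟨n, hn, hn'⟩ := h₁
  obtain ⟨m, hm, hm'⟩ := h₂
  rcases lt_trichotomy n m with h | rfl | h
  · exact ⟨m, (hn.mono (by omega)).trans hm, by rwa [hn.1 m h]⟩
  · exact ⟨n, hn.trans hm, hn'.trans hm'⟩
  · exact ⟨n, hn.trans (hm.mono (by omega)), by rwa [← hm.1 n h]⟩

theorem PathLT.asymm {γ ξ : Path a} (h₁ : PathLT γ ξ) (h₂ : PathLT ξ γ) : False :=
  PathLT.irrefl _ (h₁.trans h₂)

instance : IsStrictOrder (Path a) PathLT where
  irrefl := PathLT.irrefl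
  trans _ _ _ := PathLT.trans

/-- The last level at which the edges differ decides; both edges there end in the same vertex. -/
theorem SameTail.eq_or_lt_or_gt {n : ℕ} {γ ξ : Path a} (h : SameTail n γ ξ) :
    γ = ξ ∨ PathLT γ ξ ∨ PathLT ξ γ := by
  induction n with
  | zero => exact Or.inl (funext fun m => h.1 m (Nat.zero_le m))
  | succ n ih =>
    by_cases hn : γ n = ξ n
    · refine ih ⟨fun m hm => ?_, ?_⟩
      · rcases hm.eq_or_lt with rfl | hm
        exacts [hn, h.1 m hm]
      · exact (vertex_eq_iff_of_agree n.le_succ fun l h₁ h₂ => by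
          rwa [show l = n by omega]).mp h.2
    · rcases EdgeLT.trichotomy hn with h' | h'
      · exact Or.inr (Or.inl (pathLT_iff.mpr ⟨n, h, h'⟩))
      · exact Or.inr (Or.inr (pathLT_iff.mpr ⟨n, h.symm, h'⟩))

theorem PathLT.exists_sameTail {γ ξ : Path a} (h : PathLT γ ξ) : ∃ n, SameTail n γ ξ :=
  let ⟨n, hn, _⟩ := pathLT_iff.mp h
  ⟨n + 1, hn⟩

/-- A path larger than `γ` either has the tail of `γ` from level `n` on, or it is larger
than all the paths with this property. -/
theorem PathLT.sameTail_or_lt {n : ℕ} {γ ξ η : Path a} (h : PathLT γ η) (hξ : SameTail n γ ξ) :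
    SameTail n γ η ∨ PathLT ξ η := by
  obtain ⟨m, hm, hm'⟩ := pathLT_iff.mp h
  rcases lt_or_ge m n with hmn | hmn
  · exact Or.inl (hm.mono hmn)
  · exact Or.inr (pathLT_iff.mpr
      ⟨m, (hξ.symm.mono (by omega)).trans hm, by rwa [← hξ.1 m hmn]⟩)

theorem PathLT.splice {n : ℕ} {γ ξ : Path a} (h : PathLT γ ξ) (hs : SameTail n γ ξ) (η : Path a) :
    PathLT (splice n γ η) (splice n ξ η) := by
  obtain ⟨m, hm, hm'⟩ := pathLT_iff.mp h
  have hmn : m < n := by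
    by_contra hmn
    rw [hs.1 m (by omega)] at hm'
    exact EdgeLT.irrefl _ hm'
  refine pathLT_iff.mpr ⟨m, ⟨fun l hl => ?_, ?_⟩, ?_⟩
  · rcases lt_or_ge l n with hln | hln
    · rw [splice_of_lt hln, splice_of_lt hln, hm.1 l hl]
    · rw [splice_of_le hln, splice_of_le hln]
  · rw [vertex_splice hmn, vertex_splice hmn, hm.2]
  · rwa [splice_of_lt hmn, splice_of_lt hmn]

/-! ### Successors -/

/-- A minimal element among the larger paths with the tail of `γ` exists by finiteness; larger paths
outside this tail class exceed the whole class. -/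
theorem PathLT.exists_isSuccessor {γ ξ : Path a} (h : PathLT γ ξ) : ∃ η, IsSuccessor γ η := by
  obtain ⟨n, hn⟩ := h.exists_sameTail
  let S := {η | SameTail n γ η ∧ PathLT γ η}
  have hS : S.Finite := (finite_sameTail n γ).subset fun η hη => hη.1
  obtain ⟨η, hη, hmin⟩ := (hS.wellFoundedOn (r := PathLT)).has_min
    (s := Set.univ) ⟨⟨ξ, hn, h⟩, trivial⟩
  refine ⟨η, η.2.2, fun ζ hζ => ?_⟩
  rcases hζ.sameTail_or_lt η.2.1 with hs | hs
  · rcases (hs.symm.trans η.2.1).eq_or_lt_or_gt with h' | h' | h'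
    · exact Or.inl h'
    · exact absurd h' (hmin ⟨ζ, hs, hζ⟩ trivial)
    · exact Or.inr h'
  · exact Or.inr hs

theorem IsSuccessor.unique {γ ξ ξ' : Path a} (h : IsSuccessor γ ξ) (h' : IsSuccessor γ ξ') :
    ξ = ξ' := by
  rcases h.2 ξ' h'.1 with e | e
  · exact e.symm
  · rcases h'.2 ξ h.1 with e' | e'
    · exact e'
    · exact (e.asymm e').elim

/-- Two predecessors share a tail, so they are comparable, and the larger would lie strictly between
the smaller and `ξ`. -/
theorem IsSuccessor.eq_of_isSuccessor {γ γ' ξ : Path a} (h : IsSuccessor γ ξ)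
    (h' : IsSuccessor γ' ξ) : γ = γ' := by
  have key : ∀ {γ γ' : Path a}, IsSuccessor γ ξ → IsSuccessor γ' ξ → ¬ PathLT γ γ' := by
    intro γ γ' h h' hlt
    rcases h.2 γ' hlt with rfl | e
    · exact PathLT.irrefl _ h'.1
    · exact e.asymm h'.1
  obtain ⟨n, hn⟩ := h.1.exists_sameTail
  obtain ⟨m, hm⟩ := h'.1.exists_sameTail
  rcases ((hn.mono (le_max_left n m)).trans
    (hm.symm.mono (le_max_right n m))).eq_or_lt_or_gt with e | e | e
  · exact e
  · exact (key h h' e).elim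
  · exact (key h' h e).elim

/-- Being a successor only involves the edges before the common tail, so the tail can be exchanged.
A competitor `ζ` is compared after giving it back the tail of `γ`. -/
theorem IsSuccessor.splice {n : ℕ} {γ ξ : Path a} (h : IsSuccessor γ ξ) (hs : SameTail n γ ξ)
    (η : Path a) : IsSuccessor (splice n γ η) (splice n ξ η) := by
  refine ⟨h.1.splice hs η, fun ζ hζ => ?_⟩
  rcases hζ.sameTail_or_lt (SameTail.splice hs.2 η) with ht | ht
  · have hζη : PolyAdic.splice n ζ η = ζ := splice_eq_left fun m hm => by
      rw [← ht.1 m hm, splice_of_le hm]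
    have hv : vertex γ n = vertex ζ n := by rw [← ht.2, vertex_splice le_rfl]
    have hζγ := hζ.splice ht γ
    rw [splice_splice_left, splice_eq_self fun _ _ => rfl] at hζγ
    have hst : SameTail n ξ (PolyAdic.splice n ζ γ) :=
      ⟨fun m hm => by rw [splice_of_le hm, hs.1 m hm], by rw [vertex_splice le_rfl, ← hs.2, hv]⟩
    rcases h.2 _ hζγ with e | e
    · left
      rw [← e, splice_splice_left, hζη]
    · right
      have := e.splice hst η
      rwa [splice_splice_left, hζη] at this
  · exact Or.inr ht

/-! ### Maximal and minimal paths -/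

theorem diagVertex_natCast (d k n : ℕ) : diagVertex d (k : ℕ∞) n = min k (d * n) := by
  rcases le_total k (d * n) with h | h
  · rw [diagVertex, min_eq_left (by exact_mod_cast h), min_eq_left h]; rfl
  · rw [diagVertex, min_eq_right (by exact_mod_cast h), min_eq_right h]; rfl

theorem diagVertex_top (d n : ℕ) : diagVertex d ⊤ n = d * n := by
  rw [diagVertex, min_eq_right le_top]; rfl

theorem diagVertex_succ (d : ℕ) (k : ℕ∞) (n : ℕ) :
    diagVertex d k (n + 1) = diagVertex d k n + diagStep d k n := by
  have : diagVertex d k n ≤ diagVertex d k (n + 1) := by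
    cases k with
    | top => simp only [diagVertex_top]; gcongr; omega
    | coe k =>
      have : d * n ≤ d * (n + 1) := by gcongr; omega
      simp only [diagVertex_natCast]
      omega
  simp only [diagStep]
  omega

/-- The diagonal path follows the right boundary until it reaches `k` and is constant from then on.
Either phase rules out an edge with smaller increment into the same vertex. -/
theorem diagVertex_eq_or_diagStep_eq_zero (d : ℕ) (k : ℕ∞) (n : ℕ) :
    diagVertex d k n = d * n ∨ (diagStep d k n : ℕ) = 0 := by
  have := diagVertex_succ d k n
  cases k with
  | top => exact Or.inl (diagVertex_top d n)
  | coe k =>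
    have : d * n ≤ d * (n + 1) := by gcongr; omega
    simp only [diagVertex_natCast] at *
    omega

theorem vertex_maxPath (k : ℕ∞) (n : ℕ) : vertex (maxPath a k) n = diagVertex d k n := by
  induction n with
  | zero => simp [vertex_zero, diagVertex]
  | succ n ih => rw [vertex_succ, diagVertex_succ, ih]; rfl

theorem vertex_minPath_add (k : ℕ∞) (n : ℕ) :
    vertex (minPath a k) n + diagVertex d k n = d * n := by
  induction n with
  | zero => simp [vertex_zero, diagVertex]
  | succ n ih =>
    rw [vertex_succ, diagVertex_succ, Nat.mul_succ, ← ih]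
    have := (diagStep d k n).is_lt
    simp only [minPath, Fin.val_rev]
    omega

theorem not_pathLT_minPath (γ : Path a) (k : ℕ∞) : ¬ PathLT γ (minPath a k) := by
  rintro ⟨n, -, hv, h⟩
  rw [vertex_succ, vertex_succ] at hv
  have h₁ := vertex_minPath_add (a := a) k n
  have h₂ := diagVertex_eq_or_diagStep_eq_zero d k n
  have h₃ := (γ n).1.is_lt
  simp only [EdgeLT, minPath, Fin.lt_def, Fin.val_rev, Nat.not_lt_zero, and_false, or_false]
    at h hv h₁
  omega

theorem not_maxPath_pathLT (γ : Path a) (k : ℕ∞) : ¬ PathLT (maxPath a k) γ := by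
  rintro ⟨n, -, hv, h⟩
  rw [vertex_succ, vertex_succ, vertex_maxPath] at hv
  have h₂ := diagVertex_eq_or_diagStep_eq_zero d k n
  have h₃ := vertex_le γ n
  rcases h with h | ⟨h, h'⟩
  · simp only [maxPath, Fin.lt_def] at h hv
    omega
  · have h₄ := (γ n).2.is_lt
    have h₅ : (a (γ n).1 : ℕ) = a (maxPath a k n).1 := by rw [h]
    simp only [maxPath] at h' h₅
    omega

/-- Makes the value of `adic` at `maxPath a k` independent of the choice in its definition. Level `k
+ 1` separates `k` from `⊤`, because `k < d * (k + 1)`. -/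
theorem maxPath_injective (hd : 1 ≤ d) : Function.Injective (maxPath a) := by
  intro k l h
  have hv : ∀ n, diagVertex d k n = diagVertex d l n := fun n => by
    rw [← vertex_maxPath (a := a), h, vertex_maxPath]
  have hlt : ∀ n, n < d * (n + 1) := fun n => by nlinarith
  cases k with
  | top =>
    cases l with
    | top => rfl
    | coe l =>
      have := hv (l + 1)
      have := hlt l
      rw [diagVertex_top, diagVertex_natCast] at *
      omega
  | coe k =>
    cases l with
    | top =>
      have := hv (k + 1)
      have := hlt k
      rw [diagVertex_top, diagVertex_natCast] at *
      omega
    | coe l =>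
      have h₁ := hv (k + l + 1)
      have := hlt (k + l)
      rw [diagVertex_natCast, diagVertex_natCast] at h₁
      norm_cast
      omega

/-- The paths without a larger path are the paths `maxPath a k`. -/
theorem exists_eq_maxPath {γ : Path a} (h : ∀ ξ, ¬ PathLT γ ξ) : ∃ k, γ = maxPath a k := by
  have hidx : ∀ n, ((γ n).2 : ℕ) = a (γ n).1 - 1 := by
    intro n
    by_contra hne
    have hlt := (γ n).2.is_lt
    let e : Edge a := ⟨(γ n).1, ⟨(γ n).2 + 1, by omega⟩⟩
    refine h (Function.update γ n e) ⟨n, fun m hm => ?_, ?_, ?_⟩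
    · rw [Function.update_of_ne (by omega)]
    · rw [vertex_succ, vertex_succ, Function.update_self, vertex_congr (ξ := γ) (γ := Function.update
        γ n e) fun m hm => Function.update_of_ne (by omega) _ _]
    · rw [Function.update_self]
      exact Or.inr ⟨rfl, Nat.lt_succ_self _⟩
  -- Off the right boundary, a positive increment could be lowered by one by entering from the
  -- source one step further right; that would be a larger path.
  have hstep : ∀ n, vertex γ n = d * n ∨ ((γ n).1 : ℕ) = 0 := by
    intro n
    by_contra! hne
    have hle := vertex_le γ n
    obtain ⟨ξ, -, hξ⟩ := exists_path_through γ 0 n (vertex γ n + 1) (by omega)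
    have hlt := (γ n).1.is_lt
    let i : Fin (d + 1) := ⟨(γ n).1 - 1, by omega⟩
    rw [zero_add, vertex_zero, zero_add] at hξ
    let η : Path a := splice n ξ (Function.update γ n ⟨i, ⟨0, (a i).pos⟩⟩)
    have hη : η n = ⟨i, ⟨0, (a i).pos⟩⟩ := by
      simp only [η]
      rw [splice_of_le le_rfl, Function.update_self]
    refine h η ⟨n, fun m hm => ?_, ?_, Or.inl ?_⟩
    · simp only [η]
      rw [splice_of_le hm.le, Function.update_of_ne (by omega)]
    · rw [vertex_succ, vertex_succ, hη, vertex_splice le_rfl, hξ]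
      simp only [i]
      omega
    · rw [hη, Fin.lt_def]
      simp only [i]
      omega
  have hex : ∃ k : ℕ∞, ∀ n, vertex γ n = diagVertex d k n := by
    by_cases htop : ∀ n, vertex γ n = d * n
    · exact ⟨⊤, fun n => by rw [htop, diagVertex_top]⟩
    · push Not at htop
      -- At the first level `n₀` off the right boundary the vertex index freezes; its value there is
      -- the required `k`.
      have hn₀ := Nat.find_spec htop
      have hlt := fun m (hm : m < Nat.find htop) => not_not.mp (Nat.find_min htop hm)
      generalize Nat.find htop = n₀ at hn₀ hlt
      have hconst : ∀ n, n₀ ≤ n → vertex γ n = vertex γ n₀ ∧ vertex γ n < d * n := by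
        intro n hn
        induction n, hn using Nat.le_induction with
        | base => exact ⟨rfl, lt_of_le_of_ne (vertex_le γ n₀) hn₀⟩
        | succ n _ ih =>
          have := hstep n
          have := vertex_succ γ n
          rw [Nat.mul_succ]
          have := (γ n).1.is_lt
          refine ⟨by omega, ?_⟩
          have : vertex γ n₀ < d * n := by omega
          omega
      refine ⟨(vertex γ n₀ : ℕ), fun n => ?_⟩
      rw [diagVertex_natCast]
      rcases lt_or_ge n n₀ with hn | hn
      · have := vertex_mono γ hn.le
        have := hlt n hn
        omega
      · have := hconst n hn
        omega
  obtain ⟨k, hk⟩ := hex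
  refine ⟨k, funext fun n => ?_⟩
  have hi : (γ n).1 = diagStep d k n := by
    have h₁ := hk (n + 1)
    rw [vertex_succ, diagVertex_succ, hk n] at h₁
    exact Fin.ext (by omega)
  refine edge_ext hi ?_
  rw [hidx, hi]
  rfl

/-! ### The adic transformation -/

theorem adic_of_isSuccessor {γ ξ : Path a} (h : IsSuccessor γ ξ) : adic a γ = ξ := by
  have hex : ∃ ξ, IsSuccessor γ ξ := ⟨ξ, h⟩
  rw [adic, dif_pos hex]
  exact hex.choose_spec.unique h

theorem adic_maxPath (hd : 1 ≤ d) (k : ℕ∞) :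
    adic a (maxPath a k) = minPath a (Equiv.swap 0 ⊤ k) := by
  have hno : ¬ ∃ ξ, IsSuccessor (maxPath a k) ξ := fun ⟨ξ, h⟩ => not_maxPath_pathLT ξ k h.1
  have hex : ∃ l, maxPath a k = maxPath a l := ⟨k, rfl⟩
  rw [adic, dif_neg hno, dif_pos hex, ← maxPath_injective hd hex.choose_spec]

theorem isSuccessor_adic_or_eq_maxPath (γ : Path a) :
    IsSuccessor γ (adic a γ) ∨ ∃ k, γ = maxPath a k := by
  by_cases h : ∃ ξ, PathLT γ ξ
  · obtain ⟨ξ, hξ⟩ := h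
    obtain ⟨η, hη⟩ := hξ.exists_isSuccessor
    exact Or.inl (adic_of_isSuccessor hη ▸ hη)
  · exact Or.inr (exists_eq_maxPath (not_exists.mp h))

/-- Exchanging tails turns `γ ↦ ξ` into the adic map on the whole cylinder. Nothing else enters the
cylinder of `ξ`: predecessors are unique, and exceptional paths go to minimal paths, which have no
predecessor. -/
theorem adic_preimage_cylinder (hd : 1 ≤ d) {n : ℕ} {γ ξ : Path a} (h : IsSuccessor γ ξ)
    (hs : SameTail n γ ξ) : adic a ⁻¹' PiNat.cylinder ξ n = PiNat.cylinder γ n := by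
  ext η
  constructor
  · intro hη
    have hsucc := h.splice hs (adic a η)
    rw [splice_eq_self (γ := ξ) fun m hm => (hη m hm).symm] at hsucc
    rcases isSuccessor_adic_or_eq_maxPath η with h' | ⟨k, rfl⟩
    · rw [h'.eq_of_isSuccessor hsucc]
      exact splice_mem_cylinder n γ _
    · rw [adic_maxPath hd] at hsucc
      exact (not_pathLT_minPath _ _ hsucc.1).elim
  · intro hη
    have hsucc := h.splice hs η
    rw [splice_eq_self (γ := γ) fun m hm => (hη m hm).symm] at hsucc
    rw [Set.mem_preimage, adic_of_isSuccessor hsucc]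
    exact splice_mem_cylinder n ξ η

/-! ### Measurability -/

instance : DiscreteMeasurableSpace (Edge a) where
  forall_measurableSet s := by
    refine MeasurableSpace.measurableSet_iInf.mpr fun i => ?_
    exact MeasurableSet.of_discrete (s := Sigma.mk i ⁻¹' s)

/-- Cylinder sets of length at least `M` determine a finite measure. -/
theorem ext_of_cylinder {ι : Type*} [Countable ι] [TopologicalSpace ι] [DiscreteTopology ι]
    [MeasurableSpace ι] [BorelSpace ι] {μ ν : Measure (ℕ → ι)} [IsFiniteMeasure μ] (M : ℕ)
    (huniv : μ Set.univ = ν Set.univ)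
    (h : ∀ x n, M ≤ n → μ (PiNat.cylinder x n) = ν (PiNat.cylinder x n)) : μ = ν := by
  let C : Set (Set (ℕ → ι)) := {s | ∃ x n, M ≤ n ∧ s = PiNat.cylinder x n}
  have hC : TopologicalSpace.IsTopologicalBasis C := by
    refine TopologicalSpace.isTopologicalBasis_of_isOpen_of_nhds ?_ ?_
    · rintro _ ⟨x, n, -, rfl⟩
      exact PiNat.isOpen_cylinder _ x n
    · intro x u hx hu
      obtain ⟨_, ⟨y, n, rfl⟩, hxy, hyu⟩ :=
        (PiNat.isTopologicalBasis_cylinders fun _ : ℕ => ι).exists_subset_of_mem_open hx hu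
      rw [PiNat.mem_cylinder_iff_eq] at hxy
      exact ⟨_, ⟨x, max n M, le_max_right _ _, rfl⟩, PiNat.self_mem_cylinder x _,
        (PiNat.cylinder_anti x (le_max_left n M)).trans (hxy ▸ hyu)⟩
  refine ext_of_generate_finite C (BorelSpace.measurable_eq.trans hC.borel_eq_generateFrom) ?_ ?_
    huniv
  · rintro _ ⟨x, n, hn, rfl⟩ _ ⟨y, m, hm, rfl⟩ ⟨z, hz, hz'⟩
    rw [PiNat.mem_cylinder_iff_eq] at hz hz'
    refine ⟨z, max n m, hn.trans (le_max_left n m), ?_⟩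
    rw [← hz, ← hz']
    ext w
    simp only [Set.mem_inter_iff, PiNat.mem_cylinder_iff, lt_max_iff]
    grind
  · rintro _ ⟨x, n, hn, rfl⟩
    exact h x n hn

theorem measurableSet_cylinder (γ : Path a) (n : ℕ) : MeasurableSet (PiNat.cylinder γ n) :=
  (PiNat.isOpen_cylinder _ γ n).measurableSet

theorem continuousAt_adic {γ ξ : Path a} (h : IsSuccessor γ ξ) : ContinuousAt (adic a) γ := by
  obtain ⟨n, hn⟩ := h.1.exists_sameTail
  have hc : Continuous (splice n ξ) := by
    refine continuous_pi fun m => ?_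
    rcases lt_or_ge m n with hm | hm
    · simpa only [splice_of_lt hm] using continuous_const
    · simpa only [splice_of_le hm] using continuous_apply m
  refine hc.continuousAt.congr ?_
  filter_upwards [(PiNat.isOpen_cylinder _ γ n).mem_nhds (PiNat.self_mem_cylinder γ n)] with η hη
  have := h.splice hn η
  rw [splice_eq_self (γ := γ) fun m hm => (hη m hm).symm] at this
  exact (adic_of_isSuccessor this).symm

/-- The map is continuous at every path with a successor, and only countably many paths have none.
-/
theorem measurable_adic : Measurable (adic a) := by
  refine measurable_of_isOpen fun s hs => ?_
  have hcount : (Set.range (maxPath a)).Countable := Set.countable_range _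
  have : adic a ⁻¹' s = interior (adic a ⁻¹' s) ∪ (adic a ⁻¹' s ∩ Set.range (maxPath a)) := by
    refine Set.Subset.antisymm (fun γ hγ => ?_)
      (Set.union_subset interior_subset Set.inter_subset_left)
    rcases isSuccessor_adic_or_eq_maxPath γ with h | ⟨k, rfl⟩
    · exact Or.inl (mem_interior_iff_mem_nhds.mpr (continuousAt_adic h (hs.mem_nhds hγ)))
    · exact Or.inr ⟨hγ, k, rfl⟩
  rw [this]
  exact isOpen_interior.measurableSet.union
    (hcount.mono Set.inter_subset_right).measurableSet

/-! ### Invariant measures -/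

variable {μ : Measure (Path a)}

theorem measure_cylinder_eq_of_isSuccessor (hd : 1 ≤ d) (hμ : MeasurePreserving (adic a) μ μ)
    {n : ℕ} {γ ξ : Path a} (h : IsSuccessor γ ξ) (hs : SameTail n γ ξ) :
    μ (PiNat.cylinder γ n) = μ (PiNat.cylinder ξ n) := by
  rw [← adic_preimage_cylinder hd h hs,
    hμ.measure_preimage (measurableSet_cylinder ξ n).nullMeasurableSet]

/-- Iterated successors of `γ` stay in the finite tail class until `ξ` is reached; the induction
runs along the reversed order on that class. -/
theorem measure_cylinder_eq_of_pathLT (hd : 1 ≤ d) (hμ : MeasurePreserving (adic a) μ μ)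
    {n : ℕ} {γ ξ : Path a} (h : PathLT γ ξ) (hs : SameTail n γ ξ) :
    μ (PiNat.cylinder γ n) = μ (PiNat.cylinder ξ n) := by
  have hwf := (finite_sameTail n ξ).wellFoundedOn (r := Function.swap PathLT)
  refine hwf.induction (P := fun γ => PathLT γ ξ → μ (PiNat.cylinder γ n) =
    μ (PiNat.cylinder ξ n)) hs.symm (fun γ hγ ih hlt => ?_) h
  obtain ⟨η, hη⟩ := hlt.exists_isSuccessor
  have hγη : SameTail n γ η := by
    rcases hη.2 ξ hlt with rfl | h'
    · exact hγ.symm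
    · rcases hη.1.sameTail_or_lt hγ.symm with h'' | h''
      · exact h''
      · exact (h'.asymm h'').elim
  rw [measure_cylinder_eq_of_isSuccessor hd hμ hη hγη]
  rcases hη.2 ξ hlt with rfl | h'
  · rfl
  · exact ih η (hγ.trans hγη) hη.1 h'

/-- An invariant measure gives the same mass to all cylinder sets that end in the same vertex. -/
theorem measure_cylinder_eq (hd : 1 ≤ d) (hμ : MeasurePreserving (adic a) μ μ) {n : ℕ}
    {γ ξ : Path a} (h : vertex γ n = vertex ξ n) :
    μ (PiNat.cylinder γ n) = μ (PiNat.cylinder ξ n) := by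
  have hs : SameTail n γ (splice n ξ γ) :=
    ⟨fun m hm => (splice_of_le hm ξ γ).symm, by rw [vertex_splice le_rfl, h]⟩
  rw [← cylinder_splice n ξ γ]
  rcases hs.eq_or_lt_or_gt with h' | h' | h'
  · rw [← h']
  · exact measure_cylinder_eq_of_pathLT hd hμ h' hs
  · exact (measure_cylinder_eq_of_pathLT hd hμ h' hs.symm).symm

theorem vertex_comp_swap (γ : Path a) {s t n : ℕ} (hs : s < n) (ht : t < n) :
    vertex (γ ∘ Equiv.swap s t) n = vertex γ n := by
  refine Finset.sum_equiv (Equiv.swap s t) (fun m => ?_) fun m _ => rfl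
  rw [Finset.mem_range, Finset.mem_range]
  rcases eq_or_ne m s with rfl | h₁
  · simp [hs, ht]
  · rcases eq_or_ne m t with rfl | h₂
    · simp [hs, ht]
    · rw [Equiv.swap_apply_of_ne_of_ne h₁ h₂]

/-- Invariant measures are invariant under transpositions of the edges. -/
theorem measurePreserving_comp_swap (hd : 1 ≤ d) [IsFiniteMeasure μ]
    (hμ : MeasurePreserving (adic a) μ μ) (s t : ℕ) :
    MeasurePreserving (fun γ : Path a => γ ∘ Equiv.swap s t) μ μ := by
  have hm : Measurable (fun γ : Path a => γ ∘ Equiv.swap s t) :=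
    measurable_pi_lambda _ fun m => measurable_pi_apply _
  refine ⟨hm, ext_of_cylinder (max s t + 1) (by rw [Measure.map_apply hm .univ]; rfl)
    fun γ n hn => ?_⟩
  have hs : s < n := by omega
  have ht : t < n := by omega
  rw [Measure.map_apply hm (measurableSet_cylinder γ n),
    ← measure_cylinder_eq hd hμ (vertex_comp_swap γ hs ht)]
  congr 1
  ext η
  have hlt : ∀ m, m < n → Equiv.swap s t m < n := by
    intro m hm
    rw [Equiv.swap_apply_def]
    split_ifs <;> assumption
  simp only [Set.mem_preimage, PiNat.mem_cylinder_iff, Function.comp_apply]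
  refine ⟨fun h m hm => ?_, fun h m hm => ?_⟩
  · simpa using h _ (hlt m hm)
  · simpa using h _ (hlt m hm)

/-- Almost no path has increment `i` from some level on, but not from the root on. -/
theorem ae_forall_of_eventually (hd : 1 ≤ d) [IsFiniteMeasure μ]
    (hμ : MeasurePreserving (adic a) μ μ) (i : Fin (d + 1)) :
    ∀ᵐ γ ∂μ, (∃ n, ∀ m, n ≤ m → (γ m).1 = i) → ∀ m, (γ m).1 = i := by
  classical
  -- From level `t` on, `s` is the only exceptional position. For `s ≥ t` these sets are disjoint
  -- and exchanged by transpositions, so finite total mass forces them to be null.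
  let A : ℕ → ℕ → Set (Path a) := fun t s =>
    {γ | (γ s).1 ≠ i ∧ ∀ m, t ≤ m → m ≠ s → (γ m).1 = i}
  have hmeas : ∀ t s, MeasurableSet (A t s) := fun t s => by
    have h : ∀ m, Measurable fun γ : Path a => (γ m).1 := fun m =>
      Measurable.of_discrete.comp (measurable_pi_apply m)
    have h' : ∀ m, MeasurableSet {γ : Path a | (γ m).1 = i} := fun m =>
      h m (measurableSet_singleton i)
    have hA : A t s = {γ : Path a | (γ s).1 = i}ᶜ ∩
        ⋂ m, ⋂ (_ : t ≤ m), ⋂ (_ : m ≠ s), {γ : Path a | (γ m).1 = i} := by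
      ext γ
      simp [A]
    rw [hA]
    refine (h' s).compl.inter ?_
    exact .iInter fun m => .iInter fun _ => .iInter fun _ => h' m
  have heq : ∀ t s, t ≤ s → μ (A t s) = μ (A t t) := by
    intro t s hts
    rw [← (measurePreserving_comp_swap hd hμ t s).measure_preimage (hmeas t t).nullMeasurableSet]
    congr 1
    ext γ
    simp only [A, Set.mem_ofPred_eq, Set.mem_preimage, Function.comp_apply, Equiv.swap_apply_left]
    refine and_congr_right fun _ => ⟨fun h m hm hne => ?_, fun h m hm hne => ?_⟩
    · rcases eq_or_ne m s with rfl | h'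
      · rw [Equiv.swap_apply_right]
        exact h t le_rfl hne.symm
      · rw [Equiv.swap_apply_of_ne_of_ne hne h']
        exact h m hm h'
    · rcases eq_or_ne m t with rfl | h'
      · simpa using h s hts hne.symm
      · simpa [Equiv.swap_apply_of_ne_of_ne h' hne] using h m hm h'
  have hzero : ∀ t, μ (A t t) = 0 := by
    intro t
    have hdisj : Pairwise (Function.onFun Disjoint fun l => A t (t + l)) := by
      intro l l' hne
      refine Set.disjoint_left.mpr fun γ h h' => h.1 (h'.2 _ (by omega) (by omega))
    have hsum := measure_iUnion (μ := μ) hdisj fun l => hmeas t (t + l)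
    simp only [heq t _ (Nat.le_add_right t _)] at hsum
    by_contra h0
    rw [ENNReal.tsum_const_eq_top_of_ne_zero h0] at hsum
    exact measure_ne_top μ _ hsum
  have hae : ∀ᵐ γ ∂μ, ∀ t, γ ∉ A t t :=
    ae_all_iff.mpr fun t => measure_eq_zero_iff_ae_notMem.mp (hzero t)
  filter_upwards [hae] with γ hγ hev
  have hev' := Nat.find_spec hev
  have hmin := fun m (hm : m < Nat.find hev) => Nat.find_min hev hm
  generalize Nat.find hev = n at hev' hmin
  rcases n with _ | n
  · exact fun m => hev' m (Nat.zero_le m)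
  -- As `n + 1` is the first level from which all increments are `i`, position `n` is the only
  -- exception from level `n` on.
  · refine (hγ n ⟨fun hi => hmin n n.lt_succ_self fun m hm => ?_, fun m hm hne => ?_⟩).elim
    · rcases hm.eq_or_lt with rfl | hm
      exacts [hi, hev' m hm]
    · exact hev' m (by omega)

/-! ### Paths at bounded distance from one side of the diagram -/

theorem exists_forall_ge_eq_of_bounded {f : ℕ → ℕ} (hf : Monotone f) {k : ℕ} (hk : ∀ n, f n ≤ k) :
    ∃ n, ∀ m, n ≤ m → f m = f n := by
  obtain ⟨n, hn⟩ := Nat.sSup_mem (Set.range_nonempty f) ⟨k, by rintro _ ⟨n, rfl⟩; exact hk n⟩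
  refine ⟨n, fun m hm => le_antisymm ?_ (hf hm)⟩
  rw [hn]
  exact le_csSup ⟨k, by rintro _ ⟨n, rfl⟩; exact hk n⟩ ⟨m, rfl⟩

theorem eventually_first_eq_zero_of_bounded {γ : Path a} {k : ℕ} (h : ∀ n, vertex γ n ≤ k) :
    ∃ n, ∀ m, n ≤ m → (γ m).1 = 0 := by
  obtain ⟨n, hn⟩ := exists_forall_ge_eq_of_bounded (vertex_mono γ) h
  refine ⟨n, fun m hm => Fin.ext ?_⟩
  have h₁ := hn m hm
  have h₂ := hn (m + 1) (by omega)
  rw [vertex_succ] at h₂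
  simp only [Fin.val_zero]
  omega

theorem eventually_first_eq_last_of_bounded {γ : Path a} {k : ℕ}
    (h : ∀ n, d * n ≤ vertex γ n + k) : ∃ n, ∀ m, n ≤ m → (γ m).1 = Fin.last d := by
  have hmono : Monotone fun n => d * n - vertex γ n := monotone_nat_of_le_succ fun n => by
    have := (γ n).1.is_lt
    have := vertex_le γ n
    rw [vertex_succ, Nat.mul_succ]
    omega
  obtain ⟨n, hn⟩ := exists_forall_ge_eq_of_bounded hmono (k := k) fun n => by
    have := h n
    omega
  refine ⟨n, fun m hm => Fin.ext ?_⟩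
  have h₁ := hn m hm
  have h₂ := hn (m + 1) (by omega)
  have := (γ m).1.is_lt
  have := vertex_le γ m
  simp only [vertex_succ, Nat.mul_succ, Fin.val_last] at *
  omega

/-- An invariant measure that is not fully supported lives on the far left and the far right
paths. -/
theorem ae_far_left_or_far_right (hd : 1 ≤ d) [IsFiniteMeasure μ]
    (hμ : MeasurePreserving (adic a) μ μ) (hsupp : ¬ FullySupported μ) :
    ∀ᵐ γ ∂μ, (∀ m, (γ m).1 = 0) ∨ ∀ m, (γ m).1 = Fin.last d := by
  simp only [FullySupported, not_forall, not_lt, nonpos_iff_eq_zero] at hsupp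
  obtain ⟨γ, n, hγ⟩ := hsupp
  -- Every vertex of this cone is also reached by an extension of the null cylinder.
  have hnull : ∀ l, μ {ξ | vertex γ n ≤ vertex ξ (n + l) ∧
      vertex ξ (n + l) ≤ vertex γ n + d * l} = 0 := by
    intro l
    refine measure_null_of_locally_null _ fun ξ hξ => ⟨PiNat.cylinder ξ (n + l),
      mem_nhdsWithin_of_mem_nhds ((PiNat.isOpen_cylinder _ ξ _).mem_nhds
        (PiNat.self_mem_cylinder ξ _)), ?_⟩
    obtain ⟨η, hη, hv⟩ := exists_path_through γ n l (vertex ξ (n + l) - vertex γ n)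
      (by have := hξ.2; omega)
    rw [measure_cylinder_eq hd hμ (ξ := η) (by rw [hv]; have := hξ.1; omega)]
    refine measure_mono_null (PiNat.cylinder_anti η (Nat.le_add_right n l)) ?_
    rwa [PiNat.mem_cylinder_iff_eq.mp hη]
  have hae : ∀ᵐ ξ ∂μ, ∀ l, vertex ξ (n + l) < vertex γ n ∨
      vertex γ n + d * l < vertex ξ (n + l) := ae_all_iff.mpr fun l => by
    filter_upwards [measure_eq_zero_iff_ae_notMem.mp (hnull l)] with ξ hξ
    by_contra! h
    exact hξ ⟨h.1, h.2⟩
  filter_upwards [hae, ae_forall_of_eventually hd hμ 0,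
    ae_forall_of_eventually hd hμ (Fin.last d)] with ξ hξ h0 hlast
  by_cases hleft : ∀ l, vertex ξ (n + l) < vertex γ n
  · refine Or.inl (h0 (eventually_first_eq_zero_of_bounded (k := vertex γ n) fun m => ?_))
    exact (vertex_mono ξ (Nat.le_add_left m n)).trans (hleft m).le
  · push Not at hleft
    obtain ⟨l₀, hl₀⟩ := hleft
    -- Once not left of the cone, the path is to its right forever, at distance less than `d * n`
    -- from the right boundary. The larger bound also covers the levels up to `n + l₀`.
    refine Or.inr (hlast (eventually_first_eq_last_of_bounded (k := d * (n + l₀)) fun m => ?_))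
    rcases le_total m (n + l₀) with hm | hm
    · exact (Nat.mul_le_mul_left d hm).trans (Nat.le_add_left _ _)
    · obtain ⟨l, rfl⟩ := Nat.exists_eq_add_of_le hm
      have h₁ := hξ (l₀ + l)
      rw [← add_assoc] at h₁
      have h₂ := vertex_mono ξ hm
      rw [Nat.mul_add d l₀ l] at h₁
      rw [Nat.mul_add]
      omega

/-- The set of paths all of whose edges have increment `i`. -/
def sidePaths (a : Fin (d + 1) → ℕ+) (i : Fin (d + 1)) : Set (Path a) := {γ | ∀ m, (γ m).1 = i}

theorem measurableSet_sidePaths (i : Fin (d + 1)) : MeasurableSet (sidePaths a i) := by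
  rw [sidePaths, Set.ofPred_forall]
  exact .iInter fun m => (Measurable.of_discrete (f := Sigma.fst)).comp (measurable_pi_apply m)
    (measurableSet_singleton i)

theorem bernoulliMeasure_cylinder (w : PMF (Edge a)) (γ : Path a) (n : ℕ) :
    bernoulliMeasure w (PiNat.cylinder γ n) = ∏ m ∈ Finset.range n, w (γ m) := by
  rw [PiNat.cylinder_eq_pi, bernoulliMeasure,
    Measure.infinitePi_pi _ fun m _ => measurableSet_singleton _]
  exact Finset.prod_congr rfl fun m _ => PMF.toMeasure_apply_singleton _ _ (measurableSet_singleton _)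

instance (w : PMF (Edge a)) : IsProbabilityMeasure (bernoulliMeasure w) := by
  unfold bernoulliMeasure; infer_instance

theorem stepWeights_apply (i : Fin (d + 1)) (e : Edge a) :
    stepWeights a i e = if e.1 = i then ((a i : ℕ) : ℝ≥0∞)⁻¹ else 0 := rfl

/-- Up to scaling, the Bernoulli measure is the only finite invariant measure on the paths all of
whose edges have increment `i`. -/
theorem eq_smul_bernoulliMeasure (hd : 1 ≤ d) [IsFiniteMeasure μ]
    (hμ : MeasurePreserving (adic a) μ μ) {i : Fin (d + 1)} (hi : ∀ᵐ γ ∂μ, γ ∈ sidePaths a i) :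
    μ = μ Set.univ • bernoulliMeasure (stepWeights a i) := by
  refine ext_of_cylinder 0 (by simp) fun γ n _ => ?_
  rw [Measure.smul_apply, smul_eq_mul, bernoulliMeasure_cylinder]
  by_cases hγ : ∀ m < n, (γ m).1 = i
  · rw [Finset.prod_congr rfl fun m hm => by
      rw [stepWeights_apply, if_pos (hγ m (Finset.mem_range.mp hm))]]
    induction n with
    | zero => simp
    | succ n ih =>
      have hne : ((a i : ℕ) : ℝ≥0∞) ≠ 0 := Nat.cast_ne_zero.mpr (a i).ne_zero
      -- Up to a null set only the `a i` edges of increment `i` continue the cylinder; they end in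
      -- one vertex, so the pieces have equal mass.
      have hsplit : μ (PiNat.cylinder γ n) =
          ∑ j : Fin (a i), μ (PiNat.cylinder (Function.update γ n ⟨i, j⟩) (n + 1)) := by
        rw [← tsum_fintype (L := .unconditional _), ← measure_iUnion]
        · refine measure_congr ?_
          filter_upwards [hi] with ξ hξ
          refine propext ⟨fun h => Set.mem_iUnion.mpr ?_, fun h => ?_⟩
          · obtain ⟨j, hj⟩ : ∃ j, ξ n = ⟨i, j⟩ := by
              have := hξ n
              generalize ξ n = e at this
              obtain ⟨i', j⟩ := e
              obtain rfl : i' = i := this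
              exact ⟨j, rfl⟩
            refine ⟨j, fun m hm => ?_⟩
            rcases (Nat.lt_succ_iff.mp hm).eq_or_lt with rfl | hm
            · rw [Function.update_self, hj]
            · rw [Function.update_of_ne hm.ne, h m hm]
          · obtain ⟨j, hj⟩ := Set.mem_iUnion.mp h
            intro m hm
            rw [hj m (by omega), Function.update_of_ne hm.ne]
        · intro j j' hne
          refine Set.disjoint_left.mpr fun ξ h h' => hne ?_
          have := (h n n.lt_succ_self).symm.trans (h' n n.lt_succ_self)
          simpa using this
        · exact fun j => measurableSet_cylinder _ _
      have hall : ∀ j : Fin (a i), μ (PiNat.cylinder (Function.update γ n ⟨i, j⟩) (n + 1)) =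
          μ (PiNat.cylinder γ (n + 1)) := by
        intro j
        refine measure_cylinder_eq hd hμ ?_
        rw [vertex_succ, vertex_succ, Function.update_self, hγ n n.lt_succ_self,
          vertex_congr (γ := Function.update γ n ⟨i, j⟩) (ξ := γ)
            fun m hm => Function.update_of_ne hm.ne _ _]
      rw [Finset.sum_congr rfl fun j _ => hall j, Finset.sum_const, Finset.card_univ,
        Fintype.card_fin, nsmul_eq_mul, ih (Nat.zero_le n) fun m hm => hγ m (by omega)] at hsplit
      rw [Finset.prod_range_succ, ← mul_assoc, hsplit, mul_comm (_ : ℝ≥0∞) (_ : ℝ≥0∞)⁻¹,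
        ← mul_assoc, ENNReal.inv_mul_cancel hne (ENNReal.natCast_ne_top _), one_mul]
  · push Not at hγ
    obtain ⟨m, hm, hne⟩ := hγ
    rw [Finset.prod_eq_zero (Finset.mem_range.mpr hm) (by rw [stepWeights_apply, if_neg hne]),
      mul_zero]
    refine measure_mono_null (fun ξ hξ (h : ξ ∈ sidePaths a i) => hne ?_) (ae_iff.mp hi)
    rw [← hξ m hm]
    exact h m

/-! ### The odometer -/

theorem finRotate_val {b : ℕ} (x : Fin b) :
    (finRotate b x : ℕ) = if (x : ℕ) + 1 = b then 0 else (x : ℕ) + 1 := by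
  obtain ⟨k, hk⟩ := x
  obtain ⟨b, rfl⟩ : ∃ c, b = c + 1 := ⟨b - 1, by omega⟩
  rcases (Nat.lt_succ_iff.mp hk).eq_or_lt with rfl | h
  · rw [finRotate_last']
    simp
  · rw [finRotate_of_lt h, if_neg (by simpa using h.ne)]

theorem odometer_of_forall {b n : ℕ} {x : ℕ → Fin b} (h : ∀ m < n, (x m : ℕ) + 1 = b) :
    odometer b x n = finRotate b (x n) := if_pos h

theorem odometer_of_not_forall {b n : ℕ} {x : ℕ → Fin b} (h : ¬ ∀ m < n, (x m : ℕ) + 1 = b) :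
    odometer b x n = x n := if_neg h

theorem measurable_odometer (b : ℕ) : Measurable (odometer b) := by
  refine measurable_pi_lambda _ fun n => Measurable.ite ?_
    (Measurable.of_discrete.comp (measurable_pi_apply n)) (measurable_pi_apply n)
  simp only [Set.ofPred_forall]
  refine .iInter fun m => .iInter fun _ => ?_
  exact (measurable_pi_apply (X := fun _ : ℕ => Fin b) m)
    (MeasurableSet.of_discrete (s := {k : Fin b | (k : ℕ) + 1 = b}))

/-- Whether a digit is rotated depends on the earlier digits only, and rotation is injective.
Preimages of cylinders are therefore cylinders of the same length. -/
theorem odometer_agree_iff {b : ℕ} (x y : ℕ → Fin b) (n : ℕ) :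
    (∀ m < n, odometer b x m = odometer b y m) ↔ ∀ m < n, x m = y m := by
  induction n with
  | zero => simp
  | succ n ih =>
    rw [Nat.forall_lt_succ_right, Nat.forall_lt_succ_right, ih]
    refine and_congr_right fun h => ?_
    have hc : (∀ m < n, (x m : ℕ) + 1 = b) ↔ ∀ m < n, (y m : ℕ) + 1 = b :=
      forall₂_congr fun m hm => by rw [h m hm]
    simp only [odometer, hc]
    split_ifs
    · exact (finRotate b).injective.eq_iff
    · rfl

theorem odometer_surjective (b : ℕ) : Function.Surjective (odometer b) := by
  intro x
  -- Subtraction of `1`: the borrow passes through the initial zeros of `x`, exactly where the carry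
  -- passes through `y`.
  let y : ℕ → Fin b := fun n =>
    if ∀ m < n, (x m : ℕ) = 0 then (finRotate b).symm (x n) else x n
  have hy : ∀ n, (∀ m < n, (y m : ℕ) + 1 = b) ↔ ∀ m < n, (x m : ℕ) = 0 := by
    intro n
    induction n with
    | zero => simp
    | succ n ih =>
      rw [Nat.forall_lt_succ_right, Nat.forall_lt_succ_right, ih]
      refine and_congr_right fun h => ?_
      have hx : x n = finRotate b (y n) := by
        simp only [y, if_pos h, Equiv.apply_symm_apply]
      rw [hx, finRotate_val]
      split_ifs <;> simp_all
  refine ⟨y, funext fun n => ?_⟩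
  simp only [odometer, hy n]
  by_cases h : ∀ m < n, (x m : ℕ) = 0
  · simp only [y, if_pos h, Equiv.apply_symm_apply]
  · rw [if_neg h]
    exact if_neg h

instance (b : ℕ+) : IsProbabilityMeasure (odometerMeasure b) := by
  unfold odometerMeasure; infer_instance

theorem odometerMeasure_cylinder (b : ℕ+) (x : ℕ → Fin (b : ℕ)) (n : ℕ) :
    odometerMeasure b (PiNat.cylinder x n) = ((b : ℕ) : ℝ≥0∞)⁻¹ ^ n := by
  rw [PiNat.cylinder_eq_pi, odometerMeasure,
    Measure.infinitePi_pi _ fun m _ => measurableSet_singleton _]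
  simp

theorem measurePreserving_odometer (b : ℕ+) :
    MeasurePreserving (odometer b) (odometerMeasure b) (odometerMeasure b) := by
  have hm := measurable_odometer b
  have : IsFiniteMeasure ((odometerMeasure b).map (odometer b)) :=
    Measure.isFiniteMeasure_map _ _
  refine ⟨hm, ext_of_cylinder 0 (by rw [Measure.map_apply hm .univ]; rfl) fun x n _ => ?_⟩
  obtain ⟨y, rfl⟩ := odometer_surjective b x
  rw [Measure.map_apply hm (PiNat.isOpen_cylinder _ _ n).measurableSet, odometerMeasure_cylinder,
    ← odometerMeasure_cylinder b y n]
  congr 1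
  ext z
  exact odometer_agree_iff z y n

/-! ### The far left and the far right paths -/

theorem vertex_of_forall {γ : Path a} {i : Fin (d + 1)} {n : ℕ} (h : ∀ m < n, (γ m).1 = i) :
    vertex γ n = i * n := by
  rw [vertex, Finset.sum_congr rfl fun m hm => by rw [h m (Finset.mem_range.mp hm)],
    Finset.sum_const, Finset.card_range, smul_eq_mul, mul_comm]

/-- A boundary vertex is reached in only one way, as each increment must be extremal. This fails for
intermediate `i`. -/
theorem forall_of_vertex_eq {γ : Path a} {i : Fin (d + 1)} (hi : i = 0 ∨ i = Fin.last d) {n : ℕ}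
    (h : vertex γ n = i * n) : ∀ m < n, (γ m).1 = i := by
  induction n with
  | zero => simp
  | succ n ih =>
    have h₁ := (γ n).1.is_lt
    have h₂ := vertex_le γ n
    rw [vertex_succ, Nat.mul_succ] at h
    have h₃ : vertex γ n = i * n ∧ ((γ n).1 : ℕ) = i := by
      rcases hi with rfl | rfl
      · simp only [Fin.val_zero] at *
        omega
      · simp only [Fin.val_last] at *
        omega
    exact Nat.forall_lt_succ_right.mpr ⟨ih h₃.1, Fin.ext h₃.2⟩

theorem sidePath_injective (i : Fin (d + 1)) : Function.Injective (sidePath a i) := by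
  intro x y h
  funext n
  simpa [sidePath] using congrFun h n

theorem range_sidePath (i : Fin (d + 1)) : Set.range (sidePath a i) = sidePaths a i := by
  refine Set.Subset.antisymm ?_ fun γ hγ => ?_
  · rintro _ ⟨x, rfl⟩ n
    rfl
  · refine ⟨fun n => ⟨(γ n).2, (γ n).2.is_lt.trans_eq (by rw [hγ n])⟩, funext fun n => ?_⟩
    exact edge_ext (hγ n).symm rfl

theorem sidePaths_eq {i : Fin (d + 1)} (hi : i = 0 ∨ i = Fin.last d) :
    sidePaths a i = {γ | ∀ n, vertex γ n = (i : ℕ) * n} := by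
  ext γ
  exact ⟨fun h n => vertex_of_forall fun m _ => h m,
    fun h m => forall_of_vertex_eq hi (h (m + 1)) m m.lt_succ_self⟩

/-- Paths sharing a tail with a side path stay on that side, so the order compares the last
differing digit; adding `1` with carry gives the next sequence. -/
theorem isSuccessor_sidePath {i : Fin (d + 1)} (hi : i = 0 ∨ i = Fin.last d)
    {x : ℕ → Fin (a i : ℕ)} (hx : ∃ n, (x n : ℕ) + 1 ≠ a i) :
    IsSuccessor (sidePath a i x) (sidePath a i (odometer (a i) x)) := by
  have hN := Nat.find_spec hx
  have hlt := fun m (hm : m < Nat.find hx) => not_not.mp (Nat.find_min hx hm)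
  generalize Nat.find hx = N at hN hlt
  have hyN : (odometer (a i) x N : ℕ) = x N + 1 := by
    rw [odometer_of_forall hlt, finRotate_val, if_neg hN]
  have hylt : ∀ m < N, (odometer (a i) x m : ℕ) = 0 := fun m hm => by
    rw [odometer_of_forall fun l hl => hlt l (hl.trans hm), finRotate_val, if_pos (hlt m hm)]
  have hygt : ∀ m, N < m → odometer (a i) x m = x m := fun m hm =>
    odometer_of_not_forall fun h => hN (h N hm)
  generalize odometer (a i) x = y at hyN hylt hygt
  have hxy : PathLT (sidePath a i x) (sidePath a i y) :=
    ⟨N, fun m hm => by simp only [sidePath, hygt m hm], rfl, Or.inr ⟨rfl, by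
      simp only [sidePath]; omega⟩⟩
  have lt_of_edgeLT : ∀ {e e' : Edge a}, EdgeLT e e' → e.1 = e'.1 → (e.2 : ℕ) < e'.2 := by
    rintro e e' (h | h) he
    · exact (h.ne he.symm).elim
    · exact h.2
  refine ⟨hxy, fun η hη => ?_⟩
  obtain ⟨n₁, h₁⟩ := hxy.exists_sameTail
  obtain ⟨n₂, h₂⟩ := hη.exists_sameTail
  rcases ((h₂.symm.mono (le_max_right n₁ n₂)).trans (h₁.mono (le_max_left n₁ n₂))).eq_or_lt_or_gt
    with h | h | h
  · exact Or.inl h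
  -- Here `η` would lie strictly between: `m` is the last place where it differs from `x`, and `l`
  -- the last where it differs from `y`. As `y` vanishes before the carry stops at `N`, one has `N ≤
  -- l`, and each order of `m` and `l` is contradictory.
  · exfalso
    obtain ⟨m, hm, hmv, hme⟩ := hη
    obtain ⟨l, hl, hlv, hle⟩ := h
    have hm' : (x m : ℕ) < (η m).2 := lt_of_edgeLT hme (forall_of_vertex_eq hi
      (hmv.symm.trans (vertex_of_forall fun _ _ => rfl)) m m.lt_succ_self).symm
    have hl' : ((η l).2 : ℕ) < y l := lt_of_edgeLT hle (forall_of_vertex_eq hi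
      (hlv.trans (vertex_of_forall fun _ _ => rfl)) l l.lt_succ_self)
    have hηm : ∀ j, m < j → ((η j).2 : ℕ) = x j := fun j hj => by rw [← hm j hj]; rfl
    have hηl : ∀ j, l < j → ((η j).2 : ℕ) = y j := fun j hj => by rw [hl j hj]; rfl
    have hlN : N ≤ l := by
      by_contra hlN
      rw [hylt l (by omega)] at hl'
      omega
    have hy : ∀ j, N < j → (y j : ℕ) = x j := fun j hj => by rw [hygt j hj]
    rcases lt_trichotomy m l with hml | rfl | hml
    · have := hηm l hml
      rcases hlN.eq_or_lt with rfl | hlN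
      · have := hlt m hml
        have := (η m).2.is_lt
        have : (a (η m).1 : ℕ) = a i := by
          rw [forall_of_vertex_eq hi (hmv.symm.trans (vertex_of_forall fun _ _ => rfl))
            m m.lt_succ_self]
        omega
      · have := hy l hlN
        omega
    · rcases hlN.eq_or_lt with rfl | hlN
      · omega
      · have := hy m hlN
        omega
    · have := hηl m hml
      have := hy m (by omega)
      omega
  · exact Or.inr h

theorem diagStep_zero (d n : ℕ) : diagStep d 0 n = 0 :=
  Fin.ext (by simp [diagStep, diagVertex])

theorem diagStep_top (d n : ℕ) : diagStep d ⊤ n = Fin.last d :=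
  Fin.ext (by simp [diagStep, diagVertex_top, Nat.mul_succ])

theorem sidePath_eq_maxPath {i : Fin (d + 1)} {k : ℕ∞} (hk : ∀ n, diagStep d k n = i)
    {x : ℕ → Fin (a i : ℕ)} (hx : ∀ n, (x n : ℕ) + 1 = a i) : sidePath a i x = maxPath a k := by
  refine funext fun n => edge_ext (hk n).symm ?_
  have := hx n
  simp only [sidePath, maxPath, hk n]
  omega

theorem sidePath_eq_minPath {i : Fin (d + 1)} {k : ℕ∞} (hk : ∀ n, diagStep d k n = i.rev)
    {x : ℕ → Fin (a i : ℕ)} (hx : ∀ n, (x n : ℕ) = 0) : sidePath a i x = minPath a k :=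
  funext fun n => edge_ext (by simp [sidePath, minPath, hk n]) (hx n)

/-- Only the sequence of maximal digits gives a path without successor. There the swap of `0` and
`⊤` compensates the reversal of steps in `minPath`, so the image is the zero sequence on the same
side. -/
theorem semiconj_sidePath (hd : 1 ≤ d) {i : Fin (d + 1)} (hi : i = 0 ∨ i = Fin.last d) :
    Function.Semiconj (sidePath a i) (odometer (a i)) (adic a) := by
  intro x
  by_cases hx : ∃ n, (x n : ℕ) + 1 ≠ a i
  · exact (adic_of_isSuccessor (isSuccessor_sidePath hi hx)).symm
  · push Not at hx
    have hy : ∀ n, (odometer (a i) x n : ℕ) = 0 := fun n => by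
      rw [odometer_of_forall fun m _ => hx m, finRotate_val, if_pos (hx n)]
    rcases hi with rfl | rfl
    · rw [sidePath_eq_maxPath (k := 0) (diagStep_zero d) hx, adic_maxPath hd,
        Equiv.swap_apply_left]
      exact sidePath_eq_minPath (fun n => by rw [diagStep_top, Fin.rev_zero]) hy
    · rw [sidePath_eq_maxPath (k := ⊤) (diagStep_top d) hx, adic_maxPath hd,
        Equiv.swap_apply_right]
      exact sidePath_eq_minPath (fun n => by rw [diagStep_zero, Fin.rev_last]) hy

theorem measurePreserving_sidePath (i : Fin (d + 1)) :
    MeasurePreserving (sidePath a i) (odometerMeasure (a i))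
      (bernoulliMeasure (stepWeights a i)) := by
  have hm : Measurable (sidePath a i) :=
    measurable_pi_lambda _ fun n => Measurable.of_discrete.comp (measurable_pi_apply n)
  refine ⟨hm, Measure.eq_infinitePi _ fun s t ht => ?_⟩
  have hpre : sidePath a i ⁻¹' Set.pi s t = Set.pi s fun n => Sigma.mk i ⁻¹' t n := by
    ext x
    simp [sidePath]
  rw [Measure.map_apply hm (MeasurableSet.pi s.countable_toSet fun n _ => ht n), hpre,
    odometerMeasure, Measure.infinitePi_pi _ fun n _ => MeasurableSet.of_discrete]
  refine Finset.prod_congr rfl fun n _ => ?_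
  rw [PMF.toMeasure_apply_fintype,
    PMF.toMeasure_apply_fintype, Fintype.sum_sigma,
    Finset.sum_eq_single i]
  · refine Finset.sum_congr rfl fun j _ => ?_
    by_cases h : (⟨i, j⟩ : Edge a) ∈ t n
    · rw [Set.indicator_of_mem h, Set.indicator_of_mem (s := Sigma.mk i ⁻¹' t n) h,
        stepWeights_apply, if_pos rfl, PMF.uniformOfFintype_apply, Fintype.card_fin]
    · rw [Set.indicator_of_notMem h, Set.indicator_of_notMem (s := Sigma.mk i ⁻¹' t n) h]
  · intro j _ hj
    simp [stepWeights_apply, hj]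
  · simp

/-! ### The ergodic measures that are not fully supported -/

theorem ae_mem_sidePaths (i : Fin (d + 1)) :
    ∀ᵐ γ ∂bernoulliMeasure (stepWeights a i), γ ∈ sidePaths a i := by
  rw [← (measurePreserving_sidePath i).map_eq]
  refine (ae_map_iff (measurePreserving_sidePath i).measurable.aemeasurable
    (measurableSet_sidePaths i)).mpr ?_
  exact Filter.Eventually.of_forall fun x n => rfl

theorem ergodic_bernoulliMeasure (hd : 1 ≤ d) {i : Fin (d + 1)} (hi : i = 0 ∨ i = Fin.last d) :
    Ergodic (adic a) (bernoulliMeasure (stepWeights a i)) := by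
  have hμ : MeasurePreserving (adic a) (bernoulliMeasure (stepWeights a i))
      (bernoulliMeasure (stepWeights a i)) :=
    (measurePreserving_sidePath i).of_semiconj (measurePreserving_odometer (a i))
      (semiconj_sidePath hd hi) measurable_adic
  refine ⟨hμ, ⟨fun s hs hfs => ?_⟩⟩
  -- The restriction to the invariant set `s` is again invariant, hence a multiple of the measure.
  -- Evaluating at `s` shows that the mass of `s` equals its square, so it is `0` or `1`.
  have hρ := hμ.restrict_preimage hs
  rw [hfs] at hρ
  have heq := congrArg (fun ν => ν s)
    (eq_smul_bernoulliMeasure hd hρ (ae_restrict_of_ae (ae_mem_sidePaths i)))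
  simp only [Measure.restrict_apply_self, Measure.smul_apply, smul_eq_mul,
    Measure.restrict_apply_univ] at heq
  rw [Filter.eventuallyConst_set']
  by_cases h0 : bernoulliMeasure (stepWeights a i) s = 0
  · exact Or.inl (ae_eq_empty.mpr h0)
  · right
    rw [ae_eq_univ, prob_compl_eq_zero_iff hs]
    exact ((ENNReal.mul_eq_left h0 (measure_ne_top _ _)).mp heq.symm)

theorem bernoulliMeasure_cylinder_one (i : Fin (d + 1)) (e : Edge a) :
    bernoulliMeasure (stepWeights a i) (PiNat.cylinder (fun _ => e) 1) =
      if e.1 = i then ((a i : ℕ) : ℝ≥0∞)⁻¹ else 0 := by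
  rw [bernoulliMeasure_cylinder, Finset.prod_range_one, stepWeights_apply]

theorem not_fullySupported_bernoulliMeasure (hd : 1 ≤ d) (i : Fin (d + 1)) :
    ¬ FullySupported (bernoulliMeasure (stepWeights a i)) := by
  have : Nontrivial (Fin (d + 1)) := Fin.nontrivial_iff_two_le.mpr (by omega)
  obtain ⟨j, hj⟩ := exists_ne i
  intro h
  have := h (fun _ => ⟨j, ⟨0, (a j).pos⟩⟩) 1
  rw [bernoulliMeasure_cylinder_one, if_neg hj] at this
  exact this.ne rfl

theorem bernoulliMeasure_stepWeights_injective :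
    Function.Injective fun i => bernoulliMeasure (stepWeights a i) := by
  intro i j h
  by_contra hne
  have h' := congrArg (fun ν => ν (PiNat.cylinder (fun _ => ⟨i, ⟨0, (a i).pos⟩⟩) 1)) h
  simp only [bernoulliMeasure_cylinder_one, if_neg hne] at h'
  simp at h'

theorem eq_bernoulliMeasure_of_ergodic (hd : 1 ≤ d) {μ : Measure (Path a)}
    [IsProbabilityMeasure μ] (hμ : Ergodic (adic a) μ) (hsupp : ¬ FullySupported μ) :
    μ = bernoulliMeasure (stepWeights a 0) ∨
      μ = bernoulliMeasure (stepWeights a (Fin.last d)) := by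
  have key : ∀ {i : Fin (d + 1)}, (∀ᵐ γ ∂μ, γ ∈ sidePaths a i) →
      μ = bernoulliMeasure (stepWeights a i) := fun h => by
    simpa using eq_smul_bernoulliMeasure hd hμ.toMeasurePreserving h
  -- Forward invariance suffices for ergodicity to give the left side mass `0` or `1`.
  have hinv : sidePaths a 0 ⊆ adic a ⁻¹' sidePaths a 0 := by
    rw [← range_sidePath]
    rintro _ ⟨x, rfl⟩
    exact ⟨_, semiconj_sidePath hd (Or.inl rfl) x⟩
  rcases hμ.ae_empty_or_univ_of_ae_le_preimage (measurableSet_sidePaths 0).nullMeasurableSet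
    hinv.eventuallyLE with h | h
  · right
    refine key ?_
    filter_upwards [ae_far_left_or_far_right hd hμ.toMeasurePreserving hsupp,
      measure_eq_zero_iff_ae_notMem.mp (ae_eq_empty.mp h)] with γ h₁ h₂
    exact h₁.resolve_left h₂
  · exact Or.inl (key (Filter.eventuallyEq_univ.mp h))

end PolyAdic

theorem mainTheorem4 (d : ℕ) (hd : 1 ≤ d) (a : Fin (d + 1) → ℕ+) :
    -- the two measures are the only ones (and they are such measures)
    (∀ μ : MeasureTheory.Measure (PolyAdic.Path a), MeasureTheory.IsProbabilityMeasure μ →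
      ((Ergodic (PolyAdic.adic a) μ ∧ ¬ PolyAdic.FullySupported μ) ↔
        (μ = PolyAdic.bernoulliMeasure (PolyAdic.stepWeights a 0) ∨
          μ = PolyAdic.bernoulliMeasure (PolyAdic.stepWeights a (Fin.last d))))) ∧
    PolyAdic.bernoulliMeasure (PolyAdic.stepWeights a 0) ≠
      PolyAdic.bernoulliMeasure (PolyAdic.stepWeights a (Fin.last d)) ∧
    -- they are odometer measures on the far left paths and on the far right paths
    (∀ i : Fin (d + 1), i = 0 ∨ i = Fin.last d →
      Function.Injective (PolyAdic.sidePath a i) ∧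
      Set.range (PolyAdic.sidePath a i) =
        {γ : PolyAdic.Path a | ∀ n, PolyAdic.vertex γ n = (i : ℕ) * n} ∧
      Function.Semiconj (PolyAdic.sidePath a i) (PolyAdic.odometer (a i))
        (PolyAdic.adic a) ∧
      MeasureTheory.MeasurePreserving (PolyAdic.sidePath a i)
        (PolyAdic.odometerMeasure (a i))
        (PolyAdic.bernoulliMeasure (PolyAdic.stepWeights a i))) := by
  refine ⟨fun μ hμ => ⟨fun h => PolyAdic.eq_bernoulliMeasure_of_ergodic hd h.1 h.2, ?_⟩, ?_, ?_⟩
  · rintro (rfl | rfl)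
    · exact ⟨PolyAdic.ergodic_bernoulliMeasure hd (Or.inl rfl),
        PolyAdic.not_fullySupported_bernoulliMeasure hd _⟩
    · exact ⟨PolyAdic.ergodic_bernoulliMeasure hd (Or.inr rfl),
        PolyAdic.not_fullySupported_bernoulliMeasure hd _⟩
  · intro h
    have := congrArg Fin.val (PolyAdic.bernoulliMeasure_stepWeights_injective h)
    simp only [Fin.val_zero, Fin.val_last] at this
    omega
  · intro i hi
    exact ⟨PolyAdic.sidePath_injective i,
      (PolyAdic.range_sidePath i).trans (PolyAdic.sidePaths_eq hi),
      PolyAdic.semiconj_sidePath hd hi, PolyAdic.measurePreserving_sidePath i⟩
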